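/- Let $0<q<1$. For $a\in\mathbb{R}$ put $(a;q)_n=\prod_{i=0}^{n-1}(1-aq^i)$ and $(a;q)_\infty=\prod_{i\ge 0}(1-aq^i)$, and let $\Theta(z)=\sum_{k=-\infty}^{\infty}q^{k^2}z^k$ for $z>0$. Let $$S_n(x)=(-1)^nq^{-n^2-n/2}\sum_{k=0}^n\frac{(q;q)_n}{(q;q)_k(q;q)_{n-k}}\,q^{k^2+k/2}(-x)^k$$ be the monic Stieltjes-Wigert polynomials and, for integers $L\ge 1$, $N\ge 0$, define the partition function $$\widehat Z_{L\times N}=\frac{(-1)^{LN}}{\prod_{j=0}^{L-1}j!}\,\det\Big(S_{N+j}^{(i)}(\lambda)\Big)_{0\le i,j\le L-1},\qquad \lambda=-q^{-N-L/2}.$$ Let $\alpha=2\lfloor N/2\rfloor-N$, so that $\alpha=0$ for even $N$ and $\alpha=-1$ for odd $N$, and write $a(N)\sim b(N)$ if $\lim_{N\to\infty}a(N)/b(N)=1$. Then, as $N\to\infty$, $$q^{\frac{5N^2}{4}+\frac N2}\,\widehat Z_{1\times N}\sim\frac{q^{\frac{\alpha^2}{4}}\Theta(q^\alpha)}{(q;q)_\infty},$$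 where, for every $N$, $$\frac{q^{\frac{\alpha^2}{4}}\Theta(q^\alpha)}{(q;q)_\infty}=\frac{q^{\frac{\alpha^2}{4}}(-q^{1+\alpha};q^2)_\infty(-q^{1-\alpha};q^2)_\infty}{(q;q^2)_\infty}=\begin{cases}\dfrac{(-q;q^2)_\infty^2}{(q;q^2)_\infty},&N\text{ even},\\[2ex]\dfrac{q^{\frac14}(-1;q^2)_\infty(-q^2;q^2)_\infty}{(q;q^2)_\infty},&N\text{ odd},\end{cases}$$ and $$q^{\frac{5N^2}{2}+2N}\,\widehat Z_{2\times N}\sim\frac{q^{\frac{(\alpha-1)^2}{2}}}{4}(-q;q)_\infty(-1;q)_\infty\Big[-(q;q)_\infty^2(q;q^2)_\infty^2(q^{\alpha-\frac12};q)_\infty(q^{\frac32-\alpha};q)_\infty+(-q^{\alpha-\frac12};q)_\infty(-q^{\frac32-\alpha};q)_\infty\Big].$$ -/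

import Mathlib

open Filter Topology

noncomputable section

namespace SWPartition

/-- The finite `q`-Pochhammer symbol `(a; q)_n = ∏_{i < n} (1 - a q^i)`. -/
def qPoch (a q : ℝ) (n : ℕ) : ℝ := ∏ i ∈ Finset.range n, (1 - a * q ^ i)

/-- The infinite `q`-Pochhammer symbol `(a; q)_∞ = ∏_{i ≥ 0} (1 - a q^i)`. -/
def qPochInf (a q : ℝ) : ℝ := ∏' i : ℕ, (1 - a * q ^ i)

/-- The product defining `(a; q)_∞` converges for `0 < q < 1`. -/
theorem multipliable_qPochInf (a q : ℝ) (hq0 : 0 < q) (hq1 : q < 1) :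
    Multipliable fun i : ℕ => 1 - a * q ^ i := by
  have h : Summable fun i : ℕ => ‖-(a * q ^ i)‖ :=
    (((summable_geometric_of_lt_one hq0.le hq1).mul_left a).neg).norm
  simpa [sub_eq_add_neg] using multipliable_one_add_of_summable h

/-- The Gaussian binomial coefficient `(q;q)_n / ((q;q)_k (q;q)_{n-k})` (used for `k ≤ n`). -/
def gaussBinom (q : ℝ) (n k : ℕ) : ℝ :=
  qPoch q q n / (qPoch q q k * qPoch q q (n - k))

/-- The monic Stieltjes-Wigert polynomial
`S_n(x) = (-1)^n q^{-n² - n/2} ∑_{k=0}^n [n choose k]_q q^{k² + k/2} (-x)^k`. -/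
def stieltjesWigert (q : ℝ) (n : ℕ) : Polynomial ℝ :=
  Polynomial.C ((-1) ^ n * q ^ (-(n : ℝ) ^ 2 - (n : ℝ) / 2)) *
    ∑ k ∈ Finset.range (n + 1),
      Polynomial.C (gaussBinom q n k * q ^ ((k : ℝ) ^ 2 + (k : ℝ) / 2)) *
        (-Polynomial.X) ^ k

/-- The spectral parameter `λ = -q^{-N - L/2}`. -/
def spectralParam (q : ℝ) (L N : ℕ) : ℝ := -q ^ (-(N : ℝ) - (L : ℝ) / 2)

/-- The partition function `Ẑ_{L × N}`: the normalized Wronskian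
`(-1)^{LN} / ∏_{j<L} j! * det (S_{N+j}^{(i)}(λ))_{0 ≤ i, j ≤ L-1}`. -/
def Zhat (q : ℝ) (L N : ℕ) : ℝ :=
  (-1) ^ (L * N) / (∏ j ∈ Finset.range L, (j.factorial : ℝ)) *
    (Matrix.of fun i j : Fin L =>
      (Polynomial.derivative^[(i : ℕ)] (stieltjesWigert q (N + (j : ℕ)))).eval
        (spectralParam q L N)).det

/-- The theta function `Θ(z) = ∑_{k ∈ ℤ} q^{k²} z^k`. -/
def theta (q z : ℝ) : ℝ := ∑' k : ℤ, q ^ (k ^ 2) * z ^ k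

/-- The series defining `Θ(z)` converges for `0 < q < 1` and `z > 0`. -/
theorem summable_theta (q z : ℝ) (hq0 : 0 < q) (hq1 : q < 1) (hz : 0 < z) :
    Summable fun k : ℤ => q ^ (k ^ 2) * z ^ k := by
  have hτ : 0 < (((-Real.log q / Real.pi : ℝ) : ℂ) * Complex.I).im := by
    simpa using div_pos (neg_pos.mpr (Real.log_neg hq0 hq1)) Real.pi_pos
  have h := ((summable_jacobiTheta₂_term_iff
    (((-Real.log z / (2 * Real.pi) : ℝ) : ℂ) * Complex.I) _).mpr hτ).norm
  refine h.congr fun k => ?_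
  rw [norm_jacobiTheta₂_term, ← Real.rpow_intCast, ← Real.rpow_intCast,
    Real.rpow_def_of_pos hq0, Real.rpow_def_of_pos hz, ← Real.exp_add]
  congr 1
  have hpi := Real.pi_ne_zero
  simp only [Complex.im_ofReal_mul, Complex.I_im]
  push_cast
  field_simp
  ring

/-- The parity parameter `α = 2 ⌊N/2⌋ - N`. -/
def alpha (N : ℕ) : ℤ := 2 * ((N / 2 : ℕ) : ℤ) - (N : ℤ)

/-- Asymptotic equality `a(N) ~ b(N)` as `N → ∞`: the quotient `a(N) / b(N)` tends to `1`. -/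
def AsympEq (a b : ℕ → ℝ) : Prop := Tendsto (fun N => a N / b N) atTop (𝓝 1)

end SWPartition

end

open SWPartition

noncomputable section

namespace SWPartition

/-! ### Pochhammer symbols and Gaussian binomials -/

/-! At the chosen `λ`, completing the square turns the Stieltjes-Wigert sum into a sum of Gaussian
binomials against a Gaussian in `k - N/2`. Recentring at `⌊N/2⌋` leaves a summand that depends on
`N` only through `α`. The binomials are uniformly bounded and tend to `1/(q;q)_∞`, so dominated
convergence (`tendsto_centeredSum`) gives a theta series. The Jacobi triple product follows from the
same limit applied to the finite `q`-binomial theorem.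

For `L = 2` the `q`-Pascal rule and the reflection `k ↦ N - k` collapse the determinant to a product
of two such sums (`Zhat_two_eq`). In the limit this is a product of two series over `ℤ`. After
symmetrizing, difference and sum coordinates separate the variables up to a parity constraint, which
splits the product into a plain and an alternating part (`tsum_shiftTerm_mul_tsum`). The triple
product and its derivative at `z = 1`, Jacobi's cube identity, evaluate both. Since the claim
concerns quotients, the limits must also be nonzero; positivity of the series supplies this. -/

theorem qPoch_zero (a q : ℝ) : qPoch a q 0 = 1 := by simp [qPoch]

theorem qPoch_succ (a q : ℝ) (n : ℕ) : qPoch a q (n + 1) = qPoch a q n * (1 - a * q ^ n) :=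
  Finset.prod_range_succ _ _

theorem qPoch_succ_left (a q : ℝ) (n : ℕ) :
    qPoch a q (n + 1) = (1 - a) * qPoch (a * q) q n := by
  unfold qPoch
  rw [Finset.prod_range_succ', mul_comm]
  congr 1
  · simp
  · exact Finset.prod_congr rfl fun i _ => by ring

theorem tendsto_qPoch (a : ℝ) {q : ℝ} (hq0 : 0 < q) (hq1 : q < 1) :
    Tendsto (qPoch a q) atTop (𝓝 (qPochInf a q)) :=
  (multipliable_qPochInf a q hq0 hq1).tendsto_prod_tprod_nat

theorem qPochInf_eq_mul (a : ℝ) {q : ℝ} (hq0 : 0 < q) (hq1 : q < 1) :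
    qPochInf a q = (1 - a) * qPochInf (a * q) q := by
  refine tendsto_nhds_unique ((tendsto_qPoch a hq0 hq1).comp (tendsto_add_atTop_nat 1)) ?_
  simp only [Function.comp_def, qPoch_succ_left]
  exact (tendsto_qPoch (a * q) hq0 hq1).const_mul _

theorem qPochInf_even_mul_odd (a : ℝ) {q : ℝ} (hq0 : 0 < q) (hq1 : q < 1) :
    qPochInf a (q ^ 2) * qPochInf (a * q) (q ^ 2) = qPochInf a q := by
  have h0 : 0 < q ^ 2 := by positivity
  have h1 : q ^ 2 < 1 := pow_lt_one₀ hq0.le hq1 two_ne_zero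
  have he := multipliable_qPochInf a (q ^ 2) h0 h1
  have ho := multipliable_qPochInf (a * q) (q ^ 2) h0 h1
  have := tprod_even_mul_odd (f := fun i : ℕ => 1 - a * q ^ i)
    (by simpa [pow_mul] using he) (ho.congr fun i => by ring)
  unfold qPochInf
  rw [← this]
  congr 1
  · simp [pow_mul]
  · exact tprod_congr fun i => by ring

theorem qPochInf_mul_neg (a : ℝ) {q : ℝ} (hq0 : 0 < q) (hq1 : q < 1) :
    qPochInf a q * qPochInf (-a) q = qPochInf (a ^ 2) (q ^ 2) := by
  have h0 : 0 < q ^ 2 := by positivity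
  have h1 : q ^ 2 < 1 := pow_lt_one₀ hq0.le hq1 two_ne_zero
  refine tendsto_nhds_unique ((tendsto_qPoch a hq0 hq1).mul (tendsto_qPoch (-a) hq0 hq1)) ?_
  convert tendsto_qPoch (a ^ 2) h0 h1 using 2 with n
  unfold qPoch
  rw [← Finset.prod_mul_distrib]
  exact Finset.prod_congr rfl fun i _ => by ring

section

variable {q : ℝ}

theorem qPoch_self_pos (hq0 : 0 < q) (hq1 : q < 1) (n : ℕ) : 0 < qPoch q q n :=
  Finset.prod_pos fun i _ => by
    rw [← pow_succ']
    exact sub_pos.mpr (pow_lt_one₀ hq0.le hq1 i.succ_ne_zero)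

theorem qPoch_self_antitone (hq0 : 0 < q) (hq1 : q < 1) : Antitone (qPoch q q) :=
  antitone_nat_of_succ_le fun n => by
    rw [qPoch_succ]
    have h := qPoch_self_pos hq0 hq1 n
    have : 0 < q * q ^ n := by positivity
    nlinarith

/-- The limit of positive partial products is only nonnegative; strictness comes from absolute
convergence with nonvanishing factors. -/
theorem qPochInf_self_pos (hq0 : 0 < q) (hq1 : q < 1) : 0 < qPochInf q q := by
  refine lt_of_le_of_ne (ge_of_tendsto' (tendsto_qPoch q hq0 hq1)
    fun n => (qPoch_self_pos hq0 hq1 n).le) (Ne.symm ?_)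
  have h := tprod_one_add_ne_zero_of_summable (f := fun i : ℕ => -(q * q ^ i)) ?_ ?_
  · simpa [qPochInf, sub_eq_add_neg] using h
  · intro i
    rw [← pow_succ', ← sub_eq_add_neg]
    exact (sub_pos.mpr (pow_lt_one₀ hq0.le hq1 i.succ_ne_zero)).ne'
  · exact (((summable_geometric_of_lt_one hq0.le hq1).mul_left q).neg).norm

theorem qPochInf_self_le (hq0 : 0 < q) (hq1 : q < 1) (n : ℕ) : qPochInf q q ≤ qPoch q q n :=
  (qPoch_self_antitone hq0 hq1).le_of_tendsto (tendsto_qPoch q hq0 hq1) n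

theorem gaussBinom_nonneg (hq0 : 0 < q) (hq1 : q < 1) (n k : ℕ) : 0 ≤ gaussBinom q n k :=
  div_nonneg (qPoch_self_pos hq0 hq1 _).le
    (mul_pos (qPoch_self_pos hq0 hq1 _) (qPoch_self_pos hq0 hq1 _)).le

/-- Because `(q;q)_n` decreases from `1` to its limit, the bound is uniform in `n` and `k`, as
domination requires. -/
theorem gaussBinom_le (hq0 : 0 < q) (hq1 : q < 1) (n k : ℕ) :
    gaussBinom q n k ≤ 1 / (qPochInf q q * qPochInf q q) := by
  have hp := qPochInf_self_pos hq0 hq1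
  unfold gaussBinom
  gcongr
  · simpa [qPoch_zero] using qPoch_self_antitone hq0 hq1 (Nat.zero_le n)
  · exact (qPoch_self_pos hq0 hq1 _).le
  · exact qPochInf_self_le hq0 hq1 _
  · exact qPochInf_self_le hq0 hq1 _

theorem gaussBinom_zero (hq0 : 0 < q) (hq1 : q < 1) (n : ℕ) : gaussBinom q n 0 = 1 := by
  simp [gaussBinom, qPoch_zero, (qPoch_self_pos hq0 hq1 n).ne']

theorem gaussBinom_self (hq0 : 0 < q) (hq1 : q < 1) (n : ℕ) : gaussBinom q n n = 1 := by
  simp [gaussBinom, qPoch_zero, (qPoch_self_pos hq0 hq1 n).ne']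

theorem gaussBinom_symm {n k : ℕ} (hk : k ≤ n) : gaussBinom q n (n - k) = gaussBinom q n k := by
  rw [gaussBinom, gaussBinom, Nat.sub_sub_self hk, mul_comm]

/-- The `q`-Pascal rule. -/
theorem gaussBinom_succ_succ (hq0 : 0 < q) (hq1 : q < 1) {n k : ℕ} (hk : k < n) :
    gaussBinom q (n + 1) (k + 1) = gaussBinom q n (k + 1) + q ^ (n - k) * gaussBinom q n k := by
  obtain ⟨d, rfl⟩ := Nat.exists_eq_add_of_lt hk
  have e1 : k + d + 1 + 1 - (k + 1) = d + 1 := by omega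
  have e2 : k + d + 1 - (k + 1) = d := by omega
  have e3 : k + d + 1 - k = d + 1 := by omega
  simp only [gaussBinom, e1, e2, e3]
  have h1 := (qPoch_self_pos hq0 hq1 k).ne'
  have h2 := (qPoch_self_pos hq0 hq1 d).ne'
  have h3 := (qPoch_self_pos hq0 hq1 (k + 1)).ne'
  have h4 := (qPoch_self_pos hq0 hq1 (d + 1)).ne'
  rw [qPoch_succ q q (k + d + 1)]
  rw [qPoch_succ] at h3 h4 ⊢
  rw [qPoch_succ q q k, qPoch_succ q q d]
  have h5 := right_ne_zero_of_mul h3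
  have h6 := right_ne_zero_of_mul h4
  field_simp
  ring

/-- Summation form of the `q`-Pascal rule. -/
theorem sum_gaussBinom_succ (hq0 : 0 < q) (hq1 : q < 1) (n : ℕ) (g : ℕ → ℝ) :
    ∑ k ∈ Finset.range (n + 2), gaussBinom q (n + 1) k * g k =
      ∑ k ∈ Finset.range (n + 1), gaussBinom q n k * g k +
        ∑ k ∈ Finset.range (n + 1), gaussBinom q n k * (q ^ (n - k) * g (k + 1)) := by
  rw [Finset.sum_range_succ, Finset.sum_range_succ', Finset.sum_range_succ' _ n,
    Finset.sum_range_succ _ n]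
  simp only [gaussBinom_zero hq0 hq1, gaussBinom_self hq0 hq1, Nat.sub_self, pow_zero, one_mul]
  have : ∑ k ∈ Finset.range n, gaussBinom q (n + 1) (k + 1) * g (k + 1) =
      ∑ k ∈ Finset.range n, gaussBinom q n (k + 1) * g (k + 1) +
        ∑ k ∈ Finset.range n, gaussBinom q n k * (q ^ (n - k) * g (k + 1)) := by
    rw [← Finset.sum_add_distrib]
    refine Finset.sum_congr rfl fun k hk => ?_
    rw [gaussBinom_succ_succ hq0 hq1 (Finset.mem_range.mp hk)]
    ring
  rw [this]
  ring

/-! ### Sums weighted by Gaussian binomials -/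

/-- The sum `∑_k [N choose k]_q f(k - ⌊N/2⌋)`. -/
def centeredSum (q : ℝ) (f : ℤ → ℝ) (N : ℕ) : ℝ :=
  ∑ k ∈ Finset.range (N + 1), gaussBinom q N k * f ((k : ℤ) - (N / 2 : ℕ))

/-- The Gaussian binomial `[N choose ⌊N/2⌋ + j]_q`, extended by zero. -/
def centeredBinom (q : ℝ) (N : ℕ) (j : ℤ) : ℝ :=
  if 0 ≤ j + (N / 2 : ℕ) ∧ j + (N / 2 : ℕ) ≤ N then gaussBinom q N (j + (N / 2 : ℕ)).toNat else 0

/-- Over the fixed index set `ℤ`, `N` enters only through the coefficients, which puts the sum in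
the form needed for dominated convergence. -/
theorem centeredSum_eq_tsum (q : ℝ) (f : ℤ → ℝ) (N : ℕ) :
    centeredSum q f N = ∑' j : ℤ, centeredBinom q N j * f j := by
  rw [tsum_eq_sum (s := (Finset.range (N + 1)).image fun k : ℕ => (k : ℤ) - (N / 2 : ℕ))]
  · rw [Finset.sum_image fun a _ b _ h => by simpa using h]
    refine Finset.sum_congr rfl fun k hk => ?_
    have hk' : k ≤ N := Nat.lt_succ_iff.mp (Finset.mem_range.mp hk)
    simp [centeredBinom, hk']
  · intro j hj
    rw [centeredBinom, if_neg, zero_mul]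
    rintro ⟨h1, h2⟩
    refine hj (Finset.mem_image.mpr ⟨(j + (N / 2 : ℕ)).toNat, ?_, ?_⟩)
    · rw [Finset.mem_range]; omega
    · omega

theorem tendsto_centeredBinom (hq0 : 0 < q) (hq1 : q < 1) (j : ℤ) :
    Tendsto (fun N => centeredBinom q N j) atTop (𝓝 (qPochInf q q)⁻¹) := by
  have hp := (qPochInf_self_pos hq0 hq1).ne'
  have hT := tendsto_qPoch q hq0 hq1
  have h1 : Tendsto (fun N : ℕ => (j + (N / 2 : ℕ)).toNat) atTop atTop := by
    refine tendsto_atTop.2 fun b => ?_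
    filter_upwards [eventually_ge_atTop (2 * (b + j.natAbs) + 2)] with N hN
    omega
  have h2 : Tendsto (fun N : ℕ => N - (j + (N / 2 : ℕ)).toNat) atTop atTop := by
    refine tendsto_atTop.2 fun b => ?_
    filter_upwards [eventually_ge_atTop (2 * (b + j.natAbs) + 2)] with N hN
    omega
  have h3 := hT.div ((hT.comp h1).mul (hT.comp h2)) (mul_ne_zero hp hp)
  have e : qPochInf q q / (qPochInf q q * qPochInf q q) = (qPochInf q q)⁻¹ := by field_simp
  rw [e] at h3
  refine h3.congr' ?_
  filter_upwards [eventually_ge_atTop (2 * j.natAbs + 2)] with N hN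
  rw [centeredBinom, if_pos (by omega)]
  rfl

theorem norm_centeredBinom_le (hq0 : 0 < q) (hq1 : q < 1) (N : ℕ) (j : ℤ) :
    ‖centeredBinom q N j‖ ≤ 1 / (qPochInf q q * qPochInf q q) := by
  have hp := qPochInf_self_pos hq0 hq1
  unfold centeredBinom
  split_ifs
  · rw [Real.norm_of_nonneg (gaussBinom_nonneg hq0 hq1 _ _)]
    exact gaussBinom_le hq0 hq1 _ _
  · simp only [norm_zero]
    positivity

theorem tendsto_centeredSum (hq0 : 0 < q) (hq1 : q < 1) {f : ℤ → ℝ} (hf : Summable f) :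
    Tendsto (centeredSum q f) atTop (𝓝 ((qPochInf q q)⁻¹ * ∑' j, f j)) := by
  rw [← tsum_mul_left]
  refine Tendsto.congr (fun N => (centeredSum_eq_tsum q f N).symm) ?_
  refine tendsto_tsum_of_dominated_convergence
    (hf.norm.mul_left (1 / (qPochInf q q * qPochInf q q)))
    (fun j => (tendsto_centeredBinom hq0 hq1 j).mul_const _) (Eventually.of_forall fun N j => ?_)
  rw [norm_mul]
  exact mul_le_mul_of_nonneg_right (norm_centeredBinom_le hq0 hq1 N j) (norm_nonneg _)

/-! ### Summability of Gaussian-type series -/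

theorem summable_pow_mul_rpow_quadratic (hq0 : 0 < q) (hq1 : q < 1) {c : ℝ} (hc : 0 < c) (b : ℝ)
    (i : ℕ) : Summable fun j : ℤ => (j : ℝ) ^ i * q ^ (c * (j : ℝ) ^ 2 + b * j) := by
  have hl : Real.log q < 0 := Real.log_neg hq0 hq1
  have hT : 0 < -(c * Real.log q) / Real.pi := div_pos (by nlinarith) Real.pi_pos
  -- The parameters of the library bound are tuned so that its exponent is `c log q · j² + |b log q|
  -- |j|`.
  refine Summable.of_norm_bounded
    (summable_pow_mul_jacobiTheta₂_term_bound (|b * Real.log q| / (2 * Real.pi)) hT i)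
    fun j => ?_
  rw [norm_mul, norm_pow, Real.norm_eq_abs, Real.norm_of_nonneg (Real.rpow_nonneg hq0.le _),
    Real.rpow_def_of_pos hq0]
  push_cast
  refine mul_le_mul_of_nonneg_left (Real.exp_le_exp.mpr ?_) (by positivity)
  have h1 : b * Real.log q * j ≤ |b * Real.log q| * |(j : ℝ)| := by
    rw [← abs_mul]; exact le_abs_self _
  have hpi := Real.pi_ne_zero
  have e : -Real.pi * (-(c * Real.log q) / Real.pi * (j : ℝ) ^ 2 -
      2 * (|b * Real.log q| / (2 * Real.pi)) * |(j : ℝ)|) =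
      c * Real.log q * (j : ℝ) ^ 2 + |b * Real.log q| * |(j : ℝ)| := by
    field_simp
    ring
  rw [e]
  linarith

theorem summable_rpow_quadratic (hq0 : 0 < q) (hq1 : q < 1) {c : ℝ} (hc : 0 < c) (b d : ℝ) :
    Summable fun j : ℤ => q ^ (c * (j : ℝ) ^ 2 + b * j + d) := by
  simpa [Real.rpow_add hq0] using
    (summable_pow_mul_rpow_quadratic hq0 hq1 hc b 0).mul_right (q ^ d)

theorem summable_mul_rpow_quadratic (hq0 : 0 < q) (hq1 : q < 1) {c : ℝ} (hc : 0 < c) (b d : ℝ) :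
    Summable fun j : ℤ => (j : ℝ) * q ^ (c * (j : ℝ) ^ 2 + b * j + d) := by
  simpa [Real.rpow_add hq0, mul_assoc] using
    (summable_pow_mul_rpow_quadratic hq0 hq1 hc b 1).mul_right (q ^ d)

end

/-! ### The Jacobi triple product -/

section

variable {q : ℝ}

theorem pow_choose_two (q : ℝ) (k : ℕ) :
    q ^ (k.choose 2) = q ^ ((k : ℝ) * (k - 1) / 2) := by
  rw [← Real.rpow_natCast, Nat.cast_choose_two]

/-- The finite `q`-binomial theorem. -/
theorem qPoch_eq_sum (hq0 : 0 < q) (hq1 : q < 1) (z : ℝ) (n : ℕ) :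
    qPoch z q n =
      ∑ k ∈ Finset.range (n + 1), gaussBinom q n k * ((-z) ^ k * q ^ (k.choose 2)) := by
  induction n with
  | zero => simp [qPoch_zero, gaussBinom_zero hq0 hq1]
  | succ n ih =>
    rw [sum_gaussBinom_succ hq0 hq1, ← ih, qPoch_succ, mul_sub, mul_one, sub_eq_add_neg]
    congr 1
    rw [ih, Finset.sum_mul, ← Finset.sum_neg_distrib]
    refine Finset.sum_congr rfl fun k hk => ?_
    have hk' : k ≤ n := Nat.lt_succ_iff.mp (Finset.mem_range.mp hk)
    obtain ⟨d, rfl⟩ := Nat.exists_eq_add_of_le hk'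
    rw [Nat.add_sub_cancel_left, Nat.choose_succ_succ' k 1, Nat.choose_one_right]
    ring

theorem qPoch_add (a q : ℝ) (m n : ℕ) :
    qPoch a q (m + n) = qPoch a q m * qPoch (a * q ^ m) q n := by
  unfold qPoch
  rw [Finset.prod_range_add]
  congr 1
  exact Finset.prod_congr rfl fun i _ => by ring

/-- Each factor is inverted by `1 - z q^{-i} = -z q^{-i} (1 - q^i / z)` for `1 ≤ i ≤ m`; the powers
of `q` add up to `m(m+1)/2`. -/
theorem qPoch_div_pow (hq0 : 0 < q) {z : ℝ} (hz : z ≠ 0) (m : ℕ) :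
    qPoch (z / q ^ m) q m = (-z) ^ m * (q ^ ((m + 1).choose 2))⁻¹ * qPoch (q / z) q m := by
  induction m with
  | zero => simp [qPoch_zero]
  | succ m ih =>
    have e : z / q ^ (m + 1) * q = z / q ^ m := by rw [pow_succ]; field_simp
    rw [qPoch_succ_left, e, ih, qPoch_succ, Nat.choose_succ_succ' (m + 1) 1, Nat.choose_one_right]
    field_simp
    ring

/-- The general term of the theta series in the Jacobi triple product. -/
def tripleTerm (q z : ℝ) (j : ℤ) : ℝ := (-z) ^ j * q ^ ((j : ℝ) * (j - 1) / 2)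

/-- The finite form of the Jacobi triple product. -/
theorem qPoch_mul_qPoch_eq_centeredSum (hq0 : 0 < q) (hq1 : q < 1) {z : ℝ} (hz : z ≠ 0) (m : ℕ) :
    qPoch z q m * qPoch (q / z) q m = centeredSum q (tripleTerm q z) (2 * m) := by
  -- Starting at `z / q^m`, the first `m` of the `2m` factors produce `(q/z; q)_m` and the last `m`
  -- are `(z; q)_m`.
  have h := qPoch_eq_sum hq0 hq1 (z / q ^ m) (m + m)
  have e : z / q ^ m * q ^ m = z := by field_simp
  have hz' : -z ≠ 0 := neg_ne_zero.mpr hz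
  have hc : (-z) ^ m * (q ^ ((m + 1).choose 2))⁻¹ ≠ 0 :=
    mul_ne_zero (pow_ne_zero _ hz') (inv_ne_zero (pow_pos hq0 _).ne')
  rw [qPoch_add, e, qPoch_div_pow hq0 hz] at h
  refine mul_left_cancel₀ hc ?_
  rw [mul_comm (qPoch z q m), ← mul_assoc, h, centeredSum, Finset.mul_sum, ← two_mul]
  refine Finset.sum_congr rfl fun k _ => ?_
  rw [mul_left_comm ((-z) ^ m * _)]
  congr 1
  have e2 : 2 * m / 2 = m := by omega
  rw [tripleTerm, e2, zpow_sub₀ hz', zpow_natCast, zpow_natCast, pow_choose_two,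
    pow_choose_two, ← Real.rpow_neg hq0.le, ← neg_div, div_pow, ← pow_mul,
    ← Real.rpow_natCast q (m * k)]
  have e3 : q ^ ((k : ℝ) * (k - 1) / 2) = q ^ ((m * k : ℕ) : ℝ) *
      (q ^ (-(((m + 1 : ℕ) : ℝ) * ((m + 1 : ℕ) - 1) / 2)) *
        q ^ ((((k : ℤ) - (m : ℤ) : ℤ) : ℝ) * (((k : ℤ) - (m : ℤ) : ℤ) - 1) / 2)) := by
    rw [← Real.rpow_add hq0, ← Real.rpow_add hq0]
    congr 1
    push_cast
    ring
  rw [e3]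
  have := (Real.rpow_pos_of_pos hq0 ((m * k : ℕ) : ℝ)).ne'
  field_simp

theorem abs_tripleTerm (hq0 : 0 < q) (hq1 : q < 1) {z : ℝ} (hz : z ≠ 0) (j : ℤ) :
    |tripleTerm q z j| =
      q ^ (1 / 2 * (j : ℝ) ^ 2 + (Real.log |z| / Real.log q - 1 / 2) * j + 0) := by
  have hl : Real.log q ≠ 0 := (Real.log_neg hq0 hq1).ne
  have hz' : |z| = q ^ (Real.log |z| / Real.log q) := by
    rw [Real.rpow_def_of_pos hq0, mul_div_cancel₀ _ hl, Real.exp_log (abs_pos.mpr hz)]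
  rw [tripleTerm, abs_mul, abs_zpow, abs_neg, abs_of_pos (Real.rpow_pos_of_pos hq0 _)]
  nth_rewrite 1 [hz']
  rw [← Real.rpow_intCast, ← Real.rpow_mul hq0.le, ← Real.rpow_add hq0]
  congr 1
  ring

theorem summable_tripleTerm (hq0 : 0 < q) (hq1 : q < 1) {z : ℝ} (hz : z ≠ 0) :
    Summable (tripleTerm q z) := by
  refine Summable.of_abs ?_
  simp only [abs_tripleTerm hq0 hq1 hz]
  exact summable_rpow_quadratic hq0 hq1 one_half_pos _ _

theorem summable_mul_tripleTerm (hq0 : 0 < q) (hq1 : q < 1) {z : ℝ} (hz : z ≠ 0) :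
    Summable fun j : ℤ => (j : ℝ) * tripleTerm q z j := by
  refine Summable.of_abs ?_
  simp only [abs_mul, abs_tripleTerm hq0 hq1 hz]
  refine (summable_mul_rpow_quadratic hq0 hq1 one_half_pos
    (Real.log |z| / Real.log q - 1 / 2) 0).abs.congr fun j => ?_
  rw [abs_mul, abs_of_pos (Real.rpow_pos_of_pos hq0 _)]

theorem tendsto_two_mul_atTop : Tendsto (fun m : ℕ => 2 * m) atTop atTop :=
  tendsto_id.const_mul_atTop' two_pos

/-- The Jacobi triple product identity. -/
theorem jacobi_triple_product (hq0 : 0 < q) (hq1 : q < 1) {z : ℝ} (hz : z ≠ 0) :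
    ∑' j, tripleTerm q z j = qPochInf q q * qPochInf z q * qPochInf (q / z) q := by
  have h1 := (tendsto_centeredSum hq0 hq1 (summable_tripleTerm hq0 hq1 hz)).comp
    tendsto_two_mul_atTop
  have h2 := (tendsto_qPoch z hq0 hq1).mul (tendsto_qPoch (q / z) hq0 hq1)
  have h := tendsto_nhds_unique h1
    (h2.congr fun m => qPoch_mul_qPoch_eq_centeredSum hq0 hq1 hz m)
  have hp := (qPochInf_self_pos hq0 hq1).ne'
  rw [inv_mul_eq_iff_eq_mul₀ hp] at h
  rw [h, mul_assoc]

theorem hasDerivAt_tripleTerm_one (q : ℝ) (j : ℤ) :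
    HasDerivAt (fun z => tripleTerm q z j) (j * tripleTerm q 1 j) 1 := by
  have h := (hasDerivAt_zpow j (-1 : ℝ) (Or.inl (by norm_num))).comp (1 : ℝ)
    (hasDerivAt_neg (1 : ℝ))
  have h' := h.mul_const (q ^ ((j : ℝ) * (j - 1) / 2))
  refine h'.congr_deriv ?_
  rw [tripleTerm, zpow_sub_one₀ (by norm_num : (-1 : ℝ) ≠ 0)]
  norm_num
  ring

theorem continuous_qPoch (q : ℝ) (n : ℕ) : Continuous fun a => qPoch a q n := by
  unfold qPoch
  fun_prop

/-- This is the derivative at `z = 1` of the finite triple product. The index `m + 1` guarantees a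
factor `1 - z`, which vanishes there. -/
theorem centeredSum_mul_tripleTerm_one (hq0 : 0 < q) (hq1 : q < 1) (m : ℕ) :
    centeredSum q (fun j => (j : ℝ) * tripleTerm q 1 j) (2 * (m + 1)) =
      -(qPoch q q m * qPoch q q (m + 1)) := by
  have h1 : HasDerivAt (fun z => centeredSum q (tripleTerm q z) (2 * (m + 1)))
      (centeredSum q (fun j => (j : ℝ) * tripleTerm q 1 j) (2 * (m + 1))) 1 := by
    unfold centeredSum
    exact HasDerivAt.fun_sum fun k _ => (hasDerivAt_tripleTerm_one q _).const_mul _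
  have h2 : HasDerivAt
      (fun z => (1 - z) * (qPoch (z * q) q m * qPoch (q / z) q (m + 1)))
      (-(qPoch q q m * qPoch q q (m + 1))) 1 := by
    -- Dividing out `1 - z` in the slope leaves minus the cofactor, so only its continuity is
    -- needed.
    rw [hasDerivAt_iff_tendsto_slope]
    have hc : ContinuousAt
        (fun z : ℝ => -(qPoch (z * q) q m * qPoch (q / z) q (m + 1))) 1 := by
      refine (ContinuousAt.mul ?_ ?_).neg
      · exact ((continuous_qPoch q m).comp (continuous_mul_const q)).continuousAt
      · refine (continuous_qPoch q (m + 1)).continuousAt.comp ?_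
        exact continuousAt_const.div continuousAt_id one_ne_zero
    have ht := hc.tendsto.mono_left (nhdsWithin_le_nhds (s := {1}ᶜ))
    simp only [one_mul, div_one] at ht
    refine ht.congr' ?_
    filter_upwards [self_mem_nhdsWithin] with z hz
    have : z - 1 ≠ 0 := sub_ne_zero.mpr hz
    rw [slope_def_field]
    field_simp
    ring
  refine h1.unique (h2.congr_of_eventuallyEq ?_)
  filter_upwards [eventually_ne_nhds (one_ne_zero : (1 : ℝ) ≠ 0)] with z hz
  rw [← qPoch_mul_qPoch_eq_centeredSum hq0 hq1 hz, qPoch_succ_left, mul_assoc]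

/-- Jacobi's identity for the cube of `(q; q)_∞`. -/
theorem tsum_mul_tripleTerm_one (hq0 : 0 < q) (hq1 : q < 1) :
    ∑' j : ℤ, (j : ℝ) * tripleTerm q 1 j = -qPochInf q q ^ 3 := by
  have h1 := (tendsto_centeredSum hq0 hq1
    (summable_mul_tripleTerm hq0 hq1 (one_ne_zero : (1 : ℝ) ≠ 0))).comp
      (tendsto_two_mul_atTop.comp (tendsto_add_atTop_nat 1))
  have hT := tendsto_qPoch q hq0 hq1
  have h2 := (hT.mul (hT.comp (tendsto_add_atTop_nat 1))).neg
  have h := tendsto_nhds_unique h1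
    (h2.congr fun m => (centeredSum_mul_tripleTerm_one hq0 hq1 m).symm)
  have hp := (qPochInf_self_pos hq0 hq1).ne'
  rw [inv_mul_eq_iff_eq_mul₀ hp] at h
  rw [h]
  ring

end

/-! ### The partition functions as weighted sums -/

section

variable {q : ℝ}

theorem eval_stieltjesWigert (hq0 : 0 < q) (n : ℕ) (c : ℝ) :
    (stieltjesWigert q n).eval (-q ^ (-c)) = (-1) ^ n * q ^ (-(n : ℝ) ^ 2 - (n : ℝ) / 2) *
      ∑ k ∈ Finset.range (n + 1), gaussBinom q n k * q ^ ((k : ℝ) ^ 2 + (k : ℝ) / 2 - c * k) := by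
  simp only [stieltjesWigert, Polynomial.eval_mul, Polynomial.eval_C, Polynomial.eval_finsetSum,
    Polynomial.eval_pow, Polynomial.eval_neg, Polynomial.eval_X, neg_neg]
  congr 1
  refine Finset.sum_congr rfl fun k _ => ?_
  rw [mul_assoc, ← Real.rpow_natCast (q ^ (-c)), ← Real.rpow_mul hq0.le, ← Real.rpow_add hq0]
  ring_nf

/-- Writing `k x^{k-1} = x⁻¹ · k x^k` keeps the same Gaussian weights as the value; `-q^c` is `x⁻¹`.
-/
theorem eval_derivative_stieltjesWigert (hq0 : 0 < q) (n : ℕ) (c : ℝ) :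
    (Polynomial.derivative (stieltjesWigert q n)).eval (-q ^ (-c)) =
      (-1) ^ n * q ^ (-(n : ℝ) ^ 2 - (n : ℝ) / 2) * (-q ^ c *
      ∑ k ∈ Finset.range (n + 1),
        gaussBinom q n k * (k * q ^ ((k : ℝ) ^ 2 + (k : ℝ) / 2 - c * k))) := by
  simp only [stieltjesWigert, Polynomial.derivative_C_mul, Polynomial.derivative_sum,
    Polynomial.derivative_pow, Polynomial.derivative_neg, Polynomial.derivative_X,
    Polynomial.eval_mul, Polynomial.eval_C, Polynomial.eval_finsetSum,
    Polynomial.eval_pow, Polynomial.eval_neg, Polynomial.eval_X, Polynomial.eval_one, neg_neg]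
  congr 1
  rw [Finset.mul_sum]
  refine Finset.sum_congr rfl fun k _ => ?_
  rcases k with _ | k
  · simp
  · have e : q ^ (((k + 1 : ℕ) : ℝ) ^ 2 + ((k + 1 : ℕ) : ℝ) / 2 - c * (k + 1 : ℕ)) =
        q ^ (((k + 1 : ℕ) : ℝ) ^ 2 + ((k + 1 : ℕ) : ℝ) / 2) * (q ^ (-c)) ^ (k + 1) := by
      rw [← Real.rpow_natCast (q ^ (-c)), ← Real.rpow_mul hq0.le, ← Real.rpow_add hq0]
      ring_nf
    have e' : q ^ c * q ^ (-c) = 1 := by rw [← Real.rpow_add hq0, add_neg_cancel, Real.rpow_zero]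
    rw [e, pow_succ (q ^ (-c)), Nat.add_sub_cancel]
    linear_combination (gaussBinom q n (k + 1) * q ^ (((k + 1 : ℕ) : ℝ) ^ 2 + ((k + 1 : ℕ) : ℝ) / 2)
      * ((k + 1 : ℕ) : ℝ) * (q ^ (-c)) ^ k) * e'

theorem half_alpha (N : ℕ) : ((N / 2 : ℕ) : ℝ) = N / 2 + alpha N / 2 := by
  rw [alpha, Int.cast_sub, Int.cast_mul, Int.cast_natCast, Int.cast_natCast, Int.cast_ofNat]
  ring

/-- A centered sum whose summand depends only on `k - N / 2`. -/
theorem centeredSum_shift (q : ℝ) (f : ℝ → ℝ) (N : ℕ) :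
    centeredSum q (fun j => f (j + (alpha N : ℝ) / 2)) N =
      ∑ k ∈ Finset.range (N + 1), gaussBinom q N k * f ((k : ℝ) - N / 2) := by
  refine Finset.sum_congr rfl fun k _ => ?_
  congr 1
  beta_reduce
  congr 1
  rw [Int.cast_sub, Int.cast_natCast, Int.cast_natCast, half_alpha]
  ring

/-- Here `k² + k/2 - (N + 1/2)k = (k - N/2)² - N²/4`, and the normalization cancels all remaining
powers of `q`. -/
theorem Zhat_one_eq (hq0 : 0 < q) (N : ℕ) :
    q ^ (5 * (N : ℝ) ^ 2 / 4 + (N : ℝ) / 2) * Zhat q 1 N =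
      centeredSum q (fun j => q ^ (((j : ℝ) + (alpha N : ℝ) / 2) ^ 2)) N := by
  have e : spectralParam q 1 N = -q ^ (-((N : ℝ) + 1 / 2)) := by
    unfold spectralParam
    push_cast
    ring_nf
  rw [centeredSum_shift q (fun u => q ^ (u ^ 2))]
  simp only [Zhat, Matrix.det_fin_one, Matrix.of_apply, Fin.val_zero, Function.iterate_zero, id,
    add_zero, e, eval_stieltjesWigert hq0]
  rw [Finset.prod_range_one, Nat.factorial_zero, one_mul, Nat.cast_one, div_one]
  have s : ((-1 : ℝ) ^ N) * (-1) ^ N = 1 := by rw [← mul_pow]; norm_num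
  calc _ = ((-1 : ℝ) ^ N * (-1) ^ N) * (q ^ (5 * (N : ℝ) ^ 2 / 4 + (N : ℝ) / 2) *
        q ^ (-(N : ℝ) ^ 2 - (N : ℝ) / 2)) * ∑ k ∈ Finset.range (N + 1), gaussBinom q N k *
          q ^ ((k : ℝ) ^ 2 + (k : ℝ) / 2 - ((N : ℝ) + 1 / 2) * k) := by ring
    _ = _ := by
      rw [s, one_mul, ← Real.rpow_add hq0, Finset.mul_sum]
      refine Finset.sum_congr rfl fun k _ => ?_
      rw [mul_left_comm, ← Real.rpow_add hq0]
      ring_nf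

theorem sum_gaussBinom_reflect (q : ℝ) (f : ℝ → ℝ) (N : ℕ) :
    ∑ k ∈ Finset.range (N + 1), gaussBinom q N k * f ((k : ℝ) - N / 2) =
      ∑ k ∈ Finset.range (N + 1), gaussBinom q N k * f (-((k : ℝ) - N / 2)) := by
  rw [← Finset.sum_range_reflect]
  refine Finset.sum_congr rfl fun k hk => ?_
  have hk' : k ≤ N := Nat.lt_succ_iff.mp (Finset.mem_range.mp hk)
  have e : N + 1 - 1 - k = N - k := by omega
  rw [e, gaussBinom_symm hk', Nat.cast_sub hk']
  ring_nf

/-- The `q`-Pascal rule expresses the degree `N + 1` column through the same sums `A`, `B` as the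
degree `N` column. In the determinant the `κ²` terms and the explicit multiples of `N` cancel,
leaving `κ μ A (A + 2B)` up to sign and prefactors. -/
theorem Zhat_two_eq (hq0 : 0 < q) (hq1 : q < 1) (N : ℕ) :
    q ^ (5 * (N : ℝ) ^ 2 / 2 + 2 * (N : ℝ)) * Zhat q 2 N =
      centeredSum q (fun j => q ^ (((j : ℝ) + (alpha N : ℝ) / 2) ^ 2 +
          ((j : ℝ) + (alpha N : ℝ) / 2) / 2)) N *
        centeredSum q (fun j => (1 + 2 * ((j : ℝ) + (alpha N : ℝ) / 2)) *
          q ^ (((j : ℝ) + (alpha N : ℝ) / 2) ^ 2 + ((j : ℝ) + (alpha N : ℝ) / 2) / 2)) N := by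
  have e : spectralParam q 2 N = -q ^ (-((N : ℝ) + 1)) := by
    unfold spectralParam
    push_cast
    ring_nf
  rw [centeredSum_shift q (fun u => q ^ (u ^ 2 + u / 2)),
    centeredSum_shift q (fun u => (1 + 2 * u) * q ^ (u ^ 2 + u / 2))]
  set A := ∑ k ∈ Finset.range (N + 1),
    gaussBinom q N k * q ^ (((k : ℝ) - N / 2) ^ 2 + ((k : ℝ) - N / 2) / 2) with hA
  set B := ∑ k ∈ Finset.range (N + 1), gaussBinom q N k *
    (((k : ℝ) - N / 2) * q ^ (((k : ℝ) - N / 2) ^ 2 + ((k : ℝ) - N / 2) / 2)) with hB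
  have hAB : ∑ k ∈ Finset.range (N + 1), gaussBinom q N k * ((1 + 2 * ((k : ℝ) - N / 2)) *
      q ^ (((k : ℝ) - N / 2) ^ 2 + ((k : ℝ) - N / 2) / 2)) = A + 2 * B := by
    rw [hA, hB, Finset.mul_sum, ← Finset.sum_add_distrib]
    exact Finset.sum_congr rfl fun k _ => by ring
  have hA' : ∑ k ∈ Finset.range (N + 1),
      gaussBinom q N k * q ^ (((k : ℝ) - N / 2) ^ 2 - ((k : ℝ) - N / 2) / 2) = A := by
    rw [hA, sum_gaussBinom_reflect q (fun u => q ^ (u ^ 2 + u / 2))]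
    exact Finset.sum_congr rfl fun k _ => by ring_nf
  have hB' : ∑ k ∈ Finset.range (N + 1), gaussBinom q N k * (((k : ℝ) - N / 2) *
      q ^ (((k : ℝ) - N / 2) ^ 2 - ((k : ℝ) - N / 2) / 2)) = -B := by
    rw [hB, sum_gaussBinom_reflect q (fun u => u * q ^ (u ^ 2 + u / 2)),
      ← Finset.sum_neg_distrib]
    exact Finset.sum_congr rfl fun k _ => by ring_nf
  -- `κ` and `μ` are the constants left by completing the square at `k`, and at `k + 1` with the
  -- Pascal factor `q^{N-k}`.
  set κ := q ^ (-(N : ℝ) ^ 2 / 4 - N / 4) with hκ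
  set μ := q ^ (-(N : ℝ) ^ 2 / 4 + N / 4 + 1 / 2) with hμ
  have e1 : ∀ k : ℕ, q ^ ((k : ℝ) ^ 2 + (k : ℝ) / 2 - ((N : ℝ) + 1) * k) =
      κ * q ^ (((k : ℝ) - N / 2) ^ 2 - ((k : ℝ) - N / 2) / 2) := fun k => by
    rw [hκ, ← Real.rpow_add hq0]
    ring_nf
  have e2 : ∀ k ∈ Finset.range (N + 1), q ^ (N - k) *
      q ^ (((k + 1 : ℕ) : ℝ) ^ 2 + ((k + 1 : ℕ) : ℝ) / 2 - ((N : ℝ) + 1) * (k + 1 : ℕ)) =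
      μ * q ^ (((k : ℝ) - N / 2) ^ 2 + ((k : ℝ) - N / 2) / 2) := fun k hk => by
    have hk' : k ≤ N := Nat.lt_succ_iff.mp (Finset.mem_range.mp hk)
    rw [hμ, ← Real.rpow_natCast, Nat.cast_sub hk', ← Real.rpow_add hq0, ← Real.rpow_add hq0]
    push_cast
    ring_nf
  have hP : ∑ k ∈ Finset.range (N + 1), gaussBinom q N k *
      q ^ ((k : ℝ) ^ 2 + (k : ℝ) / 2 - ((N : ℝ) + 1) * k) = κ * A := by
    rw [← hA', Finset.mul_sum]
    exact Finset.sum_congr rfl fun k _ => by rw [e1]; ring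
  have hD : ∑ k ∈ Finset.range (N + 1), gaussBinom q N k *
      (k * q ^ ((k : ℝ) ^ 2 + (k : ℝ) / 2 - ((N : ℝ) + 1) * k)) = κ * (N / 2 * A - B) := by
    rw [sub_eq_add_neg, ← hB', ← hA', Finset.mul_sum, ← Finset.sum_add_distrib, Finset.mul_sum]
    exact Finset.sum_congr rfl fun k _ => by rw [e1]; ring
  have hP1 : ∑ k ∈ Finset.range (N + 1 + 1), gaussBinom q (N + 1) k *
      q ^ ((k : ℝ) ^ 2 + (k : ℝ) / 2 - ((N : ℝ) + 1) * k) = κ * A + μ * A := by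
    rw [sum_gaussBinom_succ hq0 hq1, hP]
    congr 1
    rw [hA, Finset.mul_sum]
    exact Finset.sum_congr rfl fun k hk => by rw [e2 k hk]; ring
  have hD1 : ∑ k ∈ Finset.range (N + 1 + 1), gaussBinom q (N + 1) k *
      (k * q ^ ((k : ℝ) ^ 2 + (k : ℝ) / 2 - ((N : ℝ) + 1) * k)) =
      κ * (N / 2 * A - B) + μ * ((N / 2 + 1) * A + B) := by
    rw [sum_gaussBinom_succ hq0 hq1 N
      (fun k => k * q ^ ((k : ℝ) ^ 2 + (k : ℝ) / 2 - ((N : ℝ) + 1) * k)), hD]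
    congr 1
    rw [hA, hB, Finset.mul_sum, ← Finset.sum_add_distrib, Finset.mul_sum]
    refine Finset.sum_congr rfl fun k hk => ?_
    rw [mul_left_comm (q ^ (N - k)), e2 k hk]
    push_cast
    ring
  simp only [Zhat, Matrix.det_fin_two, Matrix.of_apply, Fin.val_zero, Fin.val_one,
    Function.iterate_zero, Function.iterate_one, id, add_zero, e, eval_stieltjesWigert hq0,
    eval_derivative_stieltjesWigert hq0, hP, hD, hP1, hD1, hAB]
  have hpref : q ^ (5 * (N : ℝ) ^ 2 / 2 + 2 * (N : ℝ)) * (q ^ (-(N : ℝ) ^ 2 - (N : ℝ) / 2) *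
      q ^ (-((N + 1 : ℕ) : ℝ) ^ 2 - ((N + 1 : ℕ) : ℝ) / 2) * q ^ ((N : ℝ) + 1) * κ * μ) = 1 := by
    rw [hκ, hμ]
    simp only [← Real.rpow_add hq0]
    refine Eq.trans ?_ (Real.rpow_zero q)
    congr 1
    push_cast
    ring
  have s : ((-1 : ℝ) ^ N) * (-1) ^ N = 1 := by rw [← mul_pow]; norm_num
  have s2 : ((-1 : ℝ) ^ (2 * N)) = 1 := by rw [pow_mul]; norm_num
  have f2 : ∏ j ∈ Finset.range 2, (j.factorial : ℝ) = 1 := by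
    simp [Finset.prod_range_succ]
  rw [s2, f2, pow_succ (-1 : ℝ) N]
  linear_combination (q ^ (5 * (N : ℝ) ^ 2 / 2 + 2 * (N : ℝ)) *
    (q ^ (-(N : ℝ) ^ 2 - (N : ℝ) / 2) *
      q ^ (-((N + 1 : ℕ) : ℝ) ^ 2 - ((N + 1 : ℕ) : ℝ) / 2) * q ^ ((N : ℝ) + 1) * κ * μ)
      * A * (A + 2 * B)) * s + A * (A + 2 * B) * hpref

end

/-! ### Evaluation of the limits -/

section

variable {q : ℝ}

/-- Gaussian terms on the shifted lattice `ℤ + a / 2`. -/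
def shiftTerm (q : ℝ) (a j : ℤ) : ℝ :=
  q ^ (((j : ℝ) + (a : ℝ) / 2) ^ 2 + ((j : ℝ) + (a : ℝ) / 2) / 2)

theorem shiftTerm_pos (hq0 : 0 < q) (a j : ℤ) : 0 < shiftTerm q a j := Real.rpow_pos_of_pos hq0 _

theorem shiftTerm_eq (q : ℝ) (a j : ℤ) : shiftTerm q a j =
    q ^ (1 * (j : ℝ) ^ 2 + (a + 1 / 2) * j + ((a : ℝ) ^ 2 / 4 + a / 4)) := by
  unfold shiftTerm
  ring_nf

theorem summable_shiftTerm (hq0 : 0 < q) (hq1 : q < 1) (a : ℤ) : Summable (shiftTerm q a) :=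
  (summable_rpow_quadratic hq0 hq1 one_pos (a + 1 / 2 : ℝ)
    ((a : ℝ) ^ 2 / 4 + a / 4)).congr fun j => (shiftTerm_eq q a j).symm

theorem summable_linear_mul_shiftTerm (hq0 : 0 < q) (hq1 : q < 1) (a : ℤ) :
    Summable fun j : ℤ => (1 + 2 * ((j : ℝ) + (a : ℝ) / 2)) * shiftTerm q a j := by
  have h1 := (summable_shiftTerm hq0 hq1 a).mul_left (1 + a : ℝ)
  have h2 := (summable_mul_rpow_quadratic hq0 hq1 one_pos (a + 1 / 2 : ℝ)
    ((a : ℝ) ^ 2 / 4 + a / 4)).mul_left 2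
  simp only [← shiftTerm_eq] at h2
  exact (h1.add h2).congr fun j => by ring

theorem tsum_shiftTerm_pos (hq0 : 0 < q) (hq1 : q < 1) (a : ℤ) : 0 < ∑' j, shiftTerm q a j :=
  (summable_shiftTerm hq0 hq1 a).tsum_pos (fun j => (shiftTerm_pos hq0 a j).le) 0
    (shiftTerm_pos hq0 a 0)

/-- With `x = 1 + 2j + a`, the reflection `j ↦ -1 - a - j` sends `x` to `-x` and multiplies the
weight by `q^{x/2}`. Paired terms thus carry `x (1 - q^{x/2}) ≥ 0`. -/
theorem tsum_linear_mul_shiftTerm_pos (hq0 : 0 < q) (hq1 : q < 1) (a : ℤ) :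
    0 < ∑' j : ℤ, (1 + 2 * ((j : ℝ) + (a : ℝ) / 2)) * shiftTerm q a j := by
  set f : ℤ → ℝ := fun j => (1 + 2 * ((j : ℝ) + (a : ℝ) / 2)) * shiftTerm q a j with hf
  have hs : Summable f := summable_linear_mul_shiftTerm hq0 hq1 a
  have hs' : Summable (f ∘ Equiv.subLeft (-1 - a)) := (Equiv.summable_iff _).mpr hs
  have e : ∑' j, (f ∘ Equiv.subLeft (-1 - a)) j = ∑' j, f j := Equiv.tsum_eq _ f
  have key : ∀ j, f j + (f ∘ Equiv.subLeft (-1 - a)) j =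
      (1 + 2 * ((j : ℝ) + (a : ℝ) / 2)) *
        (1 - q ^ ((1 + 2 * ((j : ℝ) + (a : ℝ) / 2)) / 2)) * shiftTerm q a j := fun j => by
    have h : shiftTerm q a (-1 - a - j) =
        q ^ ((1 + 2 * ((j : ℝ) + (a : ℝ) / 2)) / 2) * shiftTerm q a j := by
      unfold shiftTerm
      rw [← Real.rpow_add hq0]
      push_cast
      ring_nf
    simp only [hf, Function.comp, Equiv.subLeft_apply, h]
    push_cast
    ring
  have hterm : ∀ x : ℝ, x ≠ 0 → 0 < x * (1 - q ^ (x / 2)) := fun x hx => by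
    rcases lt_or_gt_of_ne hx with h | h
    · exact mul_pos_of_neg_of_neg h
        (sub_neg.mpr (Real.one_lt_rpow_of_pos_of_lt_one_of_neg hq0 hq1 (by linarith)))
    · exact mul_pos h (sub_pos.mpr (Real.rpow_lt_one hq0.le hq1 (by linarith)))
  have hpos : 0 < ∑' j, (f j + (f ∘ Equiv.subLeft (-1 - a)) j) := by
    -- At `j = |a|` one has `x ≥ 1`, so this pair is strictly positive.
    refine (hs.add hs').tsum_pos (fun j => ?_) |a| ?_
    · rw [key]
      rcases eq_or_ne (1 + 2 * ((j : ℝ) + (a : ℝ) / 2)) 0 with h | h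
      · rw [h]; simp
      · exact (mul_pos (hterm _ h) (shiftTerm_pos hq0 a j)).le
    · rw [key]
      have h1 := neg_abs_le (a : ℝ)
      have h2 := abs_nonneg (a : ℝ)
      refine mul_pos (hterm _ (ne_of_gt ?_)) (shiftTerm_pos hq0 a _)
      push_cast
      linarith
  rw [hs.tsum_add hs', e] at hpos
  linarith

theorem tripleTerm_neg_rpow (hq0 : 0 < q) (t : ℝ) (j : ℤ) :
    tripleTerm q (-q ^ t) j = q ^ ((j : ℝ) * (j - 1) / 2 + t * j) := by
  rw [tripleTerm, neg_neg, ← Real.rpow_intCast, ← Real.rpow_mul hq0.le, ← Real.rpow_add hq0,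
    add_comm]

theorem tripleTerm_rpow (hq0 : 0 < q) (t : ℝ) (j : ℤ) :
    tripleTerm q (q ^ t) j = (-1) ^ j * q ^ ((j : ℝ) * (j - 1) / 2 + t * j) := by
  rw [← tripleTerm_neg_rpow hq0, tripleTerm, tripleTerm, neg_neg, ← mul_assoc, ← mul_zpow,
    neg_one_mul]

/-- The theta series `∑ q^{s²/2}`. -/
def thetaHalf (q : ℝ) : ℝ := ∑' s : ℤ, q ^ ((s : ℝ) ^ 2 / 2)

/-- The alternating theta series `∑ (-1)^s q^{s²/2}`. -/
def thetaHalfAlt (q : ℝ) : ℝ := ∑' s : ℤ, (-1) ^ s * q ^ ((s : ℝ) ^ 2 / 2)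

/-- The substitution `s = j + a - 1` makes the same theta constant serve every `a`; in the
alternating case it also costs the sign `(-1)^(a-1)`. -/
theorem thetaHalf_eq (hq0 : 0 < q) (hq1 : q < 1) (a : ℤ) :
    thetaHalf q = q ^ (((a : ℝ) - 1) ^ 2 / 2) * (qPochInf q q *
      qPochInf (-q ^ ((a : ℝ) - 1 / 2)) q * qPochInf (-q ^ (3 / 2 - (a : ℝ))) q) := by
  have hz : -q ^ ((a : ℝ) - 1 / 2) ≠ 0 := neg_ne_zero.mpr (Real.rpow_pos_of_pos hq0 _).ne'
  have hd : q / -q ^ ((a : ℝ) - 1 / 2) = -q ^ (3 / 2 - (a : ℝ)) := by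
    have e : 3 / 2 - (a : ℝ) = 1 - ((a : ℝ) - 1 / 2) := by ring
    rw [div_neg, e, Real.rpow_sub hq0 1, Real.rpow_one]
  rw [← hd, ← jacobi_triple_product hq0 hq1 hz, thetaHalf, ← tsum_mul_left,
    ← (Equiv.addRight (a - 1)).tsum_eq]
  refine tsum_congr fun j => ?_
  rw [tripleTerm_neg_rpow hq0, ← Real.rpow_add hq0, Equiv.coe_addRight]
  congr 1
  push_cast
  ring

theorem thetaHalfAlt_eq (hq0 : 0 < q) (hq1 : q < 1) (a : ℤ) :
    (-1) ^ (a - 1) * thetaHalfAlt q = q ^ (((a : ℝ) - 1) ^ 2 / 2) * (qPochInf q q *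
      qPochInf (q ^ ((a : ℝ) - 1 / 2)) q * qPochInf (q ^ (3 / 2 - (a : ℝ))) q) := by
  have hz : q ^ ((a : ℝ) - 1 / 2) ≠ 0 := (Real.rpow_pos_of_pos hq0 _).ne'
  have hd : q / q ^ ((a : ℝ) - 1 / 2) = q ^ (3 / 2 - (a : ℝ)) := by
    have e : 3 / 2 - (a : ℝ) = 1 - ((a : ℝ) - 1 / 2) := by ring
    rw [e, Real.rpow_sub hq0 1, Real.rpow_one]
  rw [← hd, ← jacobi_triple_product hq0 hq1 hz, thetaHalfAlt, ← tsum_mul_left, ← tsum_mul_left,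
    ← (Equiv.addRight (a - 1)).tsum_eq]
  refine tsum_congr fun j => ?_
  have h1 : ((-1 : ℝ)) ^ (a - 1) * (-1) ^ (a - 1) = 1 := by
    rw [← mul_zpow]
    norm_num
  have h2 : q ^ (((a : ℝ) - 1) ^ 2 / 2) * q ^ ((j : ℝ) * (j - 1) / 2 + ((a : ℝ) - 1 / 2) * j) =
      q ^ ((((j + (a - 1) : ℤ)) : ℝ) ^ 2 / 2) := by
    rw [← Real.rpow_add hq0]
    congr 1
    push_cast
    ring
  rw [tripleTerm_rpow hq0, Equiv.coe_addRight, ← h2, zpow_add₀ (by norm_num : (-1 : ℝ) ≠ 0)]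
  linear_combination ((-1) ^ j * (q ^ (((a : ℝ) - 1) ^ 2 / 2) *
    q ^ ((j : ℝ) * (j - 1) / 2 + ((a : ℝ) - 1 / 2) * j))) * h1

/-- The series over triangular numbers. -/
theorem tsum_triangular (hq0 : 0 < q) (hq1 : q < 1) :
    ∑' p : ℤ, q ^ ((p : ℝ) ^ 2 / 2 + (p : ℝ) / 2) =
      qPochInf q q * qPochInf (-1) q * qPochInf (-q) q := by
  have h := jacobi_triple_product hq0 hq1 (by norm_num : (-1 : ℝ) ≠ 0)
  rw [div_neg, div_one] at h
  rw [← h, ← (Equiv.neg ℤ).tsum_eq]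
  refine tsum_congr fun p => ?_
  simp only [tripleTerm, neg_neg, one_zpow, one_mul, Equiv.neg_apply]
  congr 1
  push_cast
  ring

theorem summable_triangular (hq0 : 0 < q) (hq1 : q < 1) :
    Summable fun p : ℤ => q ^ ((p : ℝ) ^ 2 / 2 + (p : ℝ) / 2) :=
  (summable_rpow_quadratic hq0 hq1 one_half_pos (1 / 2) 0).congr fun p => by ring_nf

theorem summable_mul_triangular (hq0 : 0 < q) (hq1 : q < 1) :
    Summable fun p : ℤ => (1 + (p : ℝ)) * q ^ ((p : ℝ) ^ 2 / 2 + (p : ℝ) / 2) := by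
  have h := (summable_mul_rpow_quadratic hq0 hq1 one_half_pos (1 / 2) 0).congr
    (g := fun p : ℤ => (p : ℝ) * q ^ ((p : ℝ) ^ 2 / 2 + (p : ℝ) / 2)) fun p => by ring_nf
  exact ((summable_triangular hq0 hq1).add h).congr fun p => by ring

/-- The involution `p ↦ -1 - p` fixes `p(p+1)/2` and sends the weight `1 + p` to `1 - (1 + p)`. -/
theorem tsum_mul_triangular (hq0 : 0 < q) (hq1 : q < 1) :
    ∑' p : ℤ, (1 + (p : ℝ)) * q ^ ((p : ℝ) ^ 2 / 2 + (p : ℝ) / 2) =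
      1 / 2 * ∑' p : ℤ, q ^ ((p : ℝ) ^ 2 / 2 + (p : ℝ) / 2) := by
  have hs := summable_mul_triangular hq0 hq1
  have e := (Equiv.subLeft (-1 : ℤ)).tsum_eq
    fun p : ℤ => (1 + (p : ℝ)) * q ^ ((p : ℝ) ^ 2 / 2 + (p : ℝ) / 2)
  have e1 : ∀ p : ℤ, (1 + ((Equiv.subLeft (-1 : ℤ) p : ℤ) : ℝ)) *
      q ^ (((Equiv.subLeft (-1 : ℤ) p : ℤ) : ℝ) ^ 2 / 2 +
        ((Equiv.subLeft (-1 : ℤ) p : ℤ) : ℝ) / 2) =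
      q ^ ((p : ℝ) ^ 2 / 2 + (p : ℝ) / 2) -
        (1 + (p : ℝ)) * q ^ ((p : ℝ) ^ 2 / 2 + (p : ℝ) / 2) := fun p => by
    rw [Equiv.subLeft_apply]
    push_cast
    have : (-1 - (p : ℝ)) ^ 2 / 2 + (-1 - (p : ℝ)) / 2 = (p : ℝ) ^ 2 / 2 + (p : ℝ) / 2 := by ring
    rw [this]
    ring
  simp only [e1] at e
  rw [(summable_triangular hq0 hq1).tsum_sub hs] at e
  linarith

theorem summable_neg_one_zpow_mul {f : ℤ → ℝ} (hf : Summable f) :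
    Summable fun j : ℤ => (-1) ^ j * f j := by
  refine Summable.of_abs (hf.abs.congr fun j => ?_)
  rw [abs_mul, abs_zpow, abs_neg, abs_one, one_zpow, one_mul]

/-- After `p ↦ -p` this is Jacobi's cube identity; the summand `1` in `1 + p` contributes nothing
because `(1; q)_∞ = 0`. -/
theorem tsum_alternating_mul_triangular (hq0 : 0 < q) (hq1 : q < 1) :
    ∑' p : ℤ, (-1) ^ p * ((1 + (p : ℝ)) * q ^ ((p : ℝ) ^ 2 / 2 + (p : ℝ) / 2)) =
      qPochInf q q ^ 3 := by
  have h := tsum_mul_tripleTerm_one hq0 hq1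
  rw [← (Equiv.subLeft (0 : ℤ)).tsum_eq] at h
  have h0 : ∑' p : ℤ, tripleTerm q 1 p = 0 := by
    rw [jacobi_triple_product hq0 hq1 one_ne_zero, qPochInf_eq_mul 1 hq0 hq1]
    ring
  rw [← (Equiv.subLeft (0 : ℤ)).tsum_eq] at h0
  have e : ∀ p : ℤ, tripleTerm q 1 (Equiv.subLeft (0 : ℤ) p) =
      (-1) ^ p * q ^ ((p : ℝ) ^ 2 / 2 + (p : ℝ) / 2) := fun p => by
    rw [tripleTerm, Equiv.subLeft_apply, zero_sub, zpow_neg, ← inv_zpow, inv_neg_one]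
    congr 2
    push_cast
    ring
  simp only [e] at h h0
  have s1 := summable_neg_one_zpow_mul (summable_triangular hq0 hq1)
  have s2 := summable_neg_one_zpow_mul (summable_mul_triangular hq0 hq1)
  have h3 : ∑' p : ℤ, ((Equiv.subLeft (0 : ℤ) p : ℤ) : ℝ) *
      ((-1) ^ p * q ^ ((p : ℝ) ^ 2 / 2 + (p : ℝ) / 2)) =
      ∑' p : ℤ, ((-1) ^ p * q ^ ((p : ℝ) ^ 2 / 2 + (p : ℝ) / 2) -
        (-1) ^ p * ((1 + (p : ℝ)) * q ^ ((p : ℝ) ^ 2 / 2 + (p : ℝ) / 2))) :=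
    tsum_congr fun p => by
      rw [Equiv.subLeft_apply]
      push_cast
      ring
  rw [h3, s1.tsum_sub s2, h0] at h
  linarith

/-- The map `(m, n) ↦ (n - m, m + n + a)` is a bijection onto the pairs `(p, s)` with `a + p + s`
even, whose indicator is `(1 + (-1)^(a+p+s)) / 2`. -/
theorem tsum_mul_tsum_parity {f g : ℤ → ℝ} (hf : Summable f) (hg : Summable g) (a : ℤ) :
    ∑' x : ℤ × ℤ, f (x.2 - x.1) * g (x.1 + x.2 + a) =
      1 / 2 * ((∑' p, f p) * (∑' s, g s) +
        (-1) ^ a * ((∑' p, (-1) ^ p * f p) * ∑' s, (-1) ^ s * g s)) := by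
  have hf' := summable_neg_one_zpow_mul hf
  have hg' := summable_neg_one_zpow_mul hg
  rw [tsum_mul_tsum_of_summable_norm hf.norm hg.norm,
    tsum_mul_tsum_of_summable_norm hf'.norm hg'.norm, ← tsum_mul_left,
    ← (summable_mul_of_summable_norm hf.norm hg.norm).tsum_add
      ((summable_mul_of_summable_norm hf'.norm hg'.norm).mul_left _), ← tsum_mul_left]
  set e : ℤ × ℤ → ℤ × ℤ := fun x => (x.2 - x.1, x.1 + x.2 + a) with he
  have hinj : Function.Injective e := by
    rintro ⟨m, n⟩ ⟨m', n'⟩ h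
    simp only [he, Prod.mk.injEq] at h ⊢
    omega
  have hsign : ∀ p s : ℤ, (-1 : ℝ) ^ a * ((-1) ^ p * f p * ((-1) ^ s * g s)) =
      (-1) ^ (a + p + s) * (f p * g s) := fun p s => by
    rw [zpow_add₀ (by norm_num), zpow_add₀ (by norm_num)]
    ring
  simp only [hsign]
  refine Eq.trans ?_ (hinj.tsum_eq ?_)
  · refine tsum_congr fun x => ?_
    have : Even (a + (x.2 - x.1) + (x.1 + x.2 + a)) := ⟨a + x.2, by ring⟩
    simp only [he, this.neg_one_zpow]
    ring
  · rintro ⟨p, s⟩ h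
    rcases Int.even_or_odd (a + p + s) with hev | hodd
    · obtain ⟨r, hr⟩ := hev
      refine ⟨(r - a - p, r - a), ?_⟩
      simp only [he, Prod.mk.injEq]
      omega
    · exact absurd (by simp [hodd.neg_one_zpow]) h

theorem tsum_mul_tsum_symmetrize {f g : ℤ → ℝ} (hf : Summable f) (hg : Summable g) (σ : ℤ ≃ ℤ) :
    (∑' j, f j) * (∑' j, g j) =
      1 / 2 * ∑' x : ℤ × ℤ, (f (σ x.1) * g x.2 + g (σ x.1) * f x.2) := by
  have hf' : Summable fun j => f (σ j) := σ.summable_iff.mpr hf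
  have hg' : Summable fun j => g (σ j) := σ.summable_iff.mpr hg
  rw [(summable_mul_of_summable_norm hf'.norm hg.norm).tsum_add
    (summable_mul_of_summable_norm hg'.norm hf.norm),
    ← tsum_mul_tsum_of_summable_norm hf'.norm hg.norm,
    ← tsum_mul_tsum_of_summable_norm hg'.norm hf.norm, σ.tsum_eq f, σ.tsum_eq g]
  ring

/-- Put `u = m + a/2`, `v = n + a/2`, and reflect `u ↦ -u` in the first factor. With `p = v - u` and
`s = u + v` the exponent is `(p² + p + s²)/2`, and symmetrizing makes the linear weight `(1 + 2v) +
(1 - 2u) = 2(1 + p)`, so the variables separate. -/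
theorem tsum_shiftTerm_mul_tsum (hq0 : 0 < q) (hq1 : q < 1) (a : ℤ) :
    (∑' j, shiftTerm q a j) *
      (∑' j : ℤ, (1 + 2 * ((j : ℝ) + (a : ℝ) / 2)) * shiftTerm q a j) =
      1 / 2 * (1 / 2 * (qPochInf q q * qPochInf (-1) q * qPochInf (-q) q) * thetaHalf q +
        (-1) ^ a * (qPochInf q q ^ 3 * thetaHalfAlt q)) := by
  have hg : Summable fun s : ℤ => q ^ ((s : ℝ) ^ 2 / 2) :=
    (summable_rpow_quadratic hq0 hq1 one_half_pos 0 0).congr fun p => by ring_nf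
  have h := tsum_mul_tsum_parity (summable_mul_triangular hq0 hq1) hg a
  rw [tsum_mul_triangular hq0 hq1, tsum_triangular hq0 hq1,
    tsum_alternating_mul_triangular hq0 hq1] at h
  rw [thetaHalf, thetaHalfAlt, ← h]
  rw [tsum_mul_tsum_symmetrize (summable_shiftTerm hq0 hq1 a)
    (summable_linear_mul_shiftTerm hq0 hq1 a) (Equiv.subLeft (-a)), ← tsum_mul_left]
  refine tsum_congr fun x => ?_
  have e : shiftTerm q a (-a - x.1) * shiftTerm q a x.2 =
      q ^ (((x.2 - x.1 : ℤ) : ℝ) ^ 2 / 2 + ((x.2 - x.1 : ℤ) : ℝ) / 2) *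
        q ^ (((x.1 + x.2 + a : ℤ) : ℝ) ^ 2 / 2) := by
    unfold shiftTerm
    rw [← Real.rpow_add hq0, ← Real.rpow_add hq0]
    congr 1
    push_cast
    ring
  rw [mul_assoc (1 + ((x.2 - x.1 : ℤ) : ℝ)), ← e, Equiv.subLeft_apply]
  push_cast
  ring

/-- Euler's identity: both `(q;q)_∞ (-q;q)_∞` and `(q;q)_∞ / (q;q²)_∞` equal `(q²;q²)_∞`. -/
theorem qPochInf_neg_mul_odd (hq0 : 0 < q) (hq1 : q < 1) :
    qPochInf (-q) q * qPochInf q (q ^ 2) = 1 := by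
  have h1 := qPochInf_mul_neg q hq0 hq1
  have h2 := qPochInf_even_mul_odd q hq0 hq1
  rw [← pow_two] at h2
  have hp := qPochInf_self_pos hq0 hq1
  have hne : qPochInf (q ^ 2) (q ^ 2) ≠ 0 := right_ne_zero_of_mul (h2.trans_ne hp.ne')
  refine mul_right_cancel₀ hne ?_
  rw [mul_assoc, h2, mul_comm, h1, one_mul]

/-- The limit of the two-row partition function. -/
theorem limit_two_eq (hq0 : 0 < q) (hq1 : q < 1) (a : ℤ) :
    q ^ (((a : ℝ) - 1) ^ 2 / 2) / 4 * qPochInf (-q) q * qPochInf (-1) q *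
      (-(qPochInf q q ^ 2 * qPochInf q (q ^ 2) ^ 2 * qPochInf (q ^ ((a : ℝ) - 1 / 2)) q *
          qPochInf (q ^ (3 / 2 - (a : ℝ))) q) +
        qPochInf (-q ^ ((a : ℝ) - 1 / 2)) q * qPochInf (-q ^ (3 / 2 - (a : ℝ))) q) =
      (qPochInf q q)⁻¹ * (∑' j, shiftTerm q a j) * ((qPochInf q q)⁻¹ *
        ∑' j : ℤ, (1 + 2 * ((j : ℝ) + (a : ℝ) / 2)) * shiftTerm q a j) := by
  have h1 := thetaHalf_eq hq0 hq1 a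
  have h2 := thetaHalfAlt_eq hq0 hq1 a
  have h3 := tsum_shiftTerm_mul_tsum hq0 hq1 a
  have h4 := qPochInf_neg_mul_odd hq0 hq1
  have h5 := qPochInf_eq_mul (-1) hq0 hq1
  have hp := (qPochInf_self_pos hq0 hq1).ne'
  rw [neg_one_mul] at h5
  rw [zpow_sub_one₀ (by norm_num : (-1 : ℝ) ≠ 0), inv_neg_one] at h2
  rw [h5] at h3 ⊢
  set P := qPochInf q q
  set M := qPochInf (-q) q
  set O := qPochInf q (q ^ 2)
  rw [mul_mul_mul_comm P⁻¹, h3]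
  -- The prefactor contributes `2M²`, so Euler's identity removes `O²` from the alternating term.
  have h6 : M ^ 2 * O ^ 2 = 1 := by rw [← mul_pow, h4, one_pow]
  have hinv : P ^ 2 * (P⁻¹ * P⁻¹) = 1 := by field_simp
  refine mul_left_cancel₀ (pow_ne_zero 2 hp) ?_
  linear_combination (-(P * M ^ 2 / 2)) * h1 + (P ^ 3 * M ^ 2 * O ^ 2 / 2) * h2 +
    (P ^ 3 * (-1) ^ a * thetaHalfAlt q / 2) * h6 -
    (1 / 2 * (M ^ 2 * P * thetaHalf q + (-1) ^ a * (P ^ 3 * thetaHalfAlt q))) * hinv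

/-- The Jacobi triple product for `Θ`. -/
theorem theta_rpow_eq (hq0 : 0 < q) (hq1 : q < 1) (a : ℝ) :
    theta q (q ^ a) = qPochInf (q ^ 2) (q ^ 2) * qPochInf (-q ^ (1 + a)) (q ^ 2) *
      qPochInf (-q ^ (1 - a)) (q ^ 2) := by
  have h0 : 0 < q ^ 2 := by positivity
  have h1 : q ^ 2 < 1 := pow_lt_one₀ hq0.le hq1 two_ne_zero
  have hz : -q ^ (1 + a) ≠ 0 := neg_ne_zero.mpr (Real.rpow_pos_of_pos hq0 _).ne'
  have hd : q ^ 2 / -q ^ (1 + a) = -q ^ (1 - a) := by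
    have e : 1 - a = 2 - (1 + a) := by ring
    rw [div_neg, e, Real.rpow_sub hq0, Real.rpow_two]
  rw [← hd, ← jacobi_triple_product h0 h1 hz]
  refine tsum_congr fun j => ?_
  rw [tripleTerm, neg_neg, ← Real.rpow_two, ← Real.rpow_mul hq0.le]
  simp only [← Real.rpow_intCast]
  rw [← Real.rpow_mul hq0.le, ← Real.rpow_mul hq0.le, ← Real.rpow_add hq0, ← Real.rpow_add hq0]
  congr 1
  push_cast
  ring

theorem summable_rpow_shift_sq (hq0 : 0 < q) (hq1 : q < 1) (a : ℤ) :
    Summable fun j : ℤ => q ^ (((j : ℝ) + (a : ℝ) / 2) ^ 2) :=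
  (summable_rpow_quadratic hq0 hq1 one_pos (a : ℝ) ((a : ℝ) ^ 2 / 4)).congr fun j => by ring_nf

theorem tsum_rpow_shift_sq (hq0 : 0 < q) (a : ℤ) :
    ∑' j : ℤ, q ^ (((j : ℝ) + (a : ℝ) / 2) ^ 2) =
      q ^ ((a : ℝ) ^ 2 / 4) * theta q (q ^ (a : ℝ)) := by
  rw [theta, ← tsum_mul_left]
  refine tsum_congr fun j => ?_
  rw [← Real.rpow_intCast q (j ^ 2), ← Real.rpow_intCast (q ^ (a : ℝ)), ← Real.rpow_mul hq0.le,
    ← Real.rpow_add hq0, ← Real.rpow_add hq0]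
  congr 1
  push_cast
  ring

theorem alpha_of_even {N : ℕ} (h : Even N) : alpha N = 0 := by
  obtain ⟨m, rfl⟩ := h
  unfold alpha
  omega

theorem alpha_of_odd {N : ℕ} (h : Odd N) : alpha N = -1 := by
  obtain ⟨m, rfl⟩ := h
  unfold alpha
  omega

/-- Asymptotics along a parameter that only depends on the parity of `N`. -/
theorem asympEq_alpha {u : ℤ → ℕ → ℝ} {l : ℤ → ℝ} (hu : ∀ a, Tendsto (u a) atTop (𝓝 (l a)))
    (hl : ∀ a, l a ≠ 0) : AsympEq (fun N => u (alpha N) N) fun N => l (alpha N) := by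
  have h : ∀ a, Tendsto (fun N => u a N / l a) atTop (𝓝 1) := fun a => by
    simpa [div_self (hl a)] using (hu a).div_const (l a)
  -- Only `α = 0` and `α = -1` occur, so two limits with fixed parameter are glued along parity.
  refine ((h 0).if' (p := fun N : ℕ => Even N) (h (-1))).congr fun N => ?_
  split_ifs with hN
  · beta_reduce
    rw [alpha_of_even hN]
  · beta_reduce
    rw [alpha_of_odd (Nat.not_even_iff_odd.mp hN)]

end

end SWPartition

end

theorem corollary1 (q : ℝ) (hq0 : 0 < q) (hq1 : q < 1) :
    -- the case `L = 1`
    AsympEq (fun N : ℕ => q ^ (5 * (N : ℝ) ^ 2 / 4 + (N : ℝ) / 2) * Zhat q 1 N)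
      (fun N : ℕ => q ^ ((alpha N : ℝ) ^ 2 / 4) * theta q (q ^ (alpha N : ℝ)) / qPochInf q q) ∧
    (∀ N : ℕ,
      q ^ ((alpha N : ℝ) ^ 2 / 4) * theta q (q ^ (alpha N : ℝ)) / qPochInf q q =
        q ^ ((alpha N : ℝ) ^ 2 / 4) * qPochInf (-q ^ (1 + (alpha N : ℝ))) (q ^ 2) *
          qPochInf (-q ^ (1 - (alpha N : ℝ))) (q ^ 2) / qPochInf q (q ^ 2)) ∧
    (∀ N : ℕ, Even N →
      q ^ ((alpha N : ℝ) ^ 2 / 4) * qPochInf (-q ^ (1 + (alpha N : ℝ))) (q ^ 2) *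
          qPochInf (-q ^ (1 - (alpha N : ℝ))) (q ^ 2) / qPochInf q (q ^ 2) =
        qPochInf (-q) (q ^ 2) ^ 2 / qPochInf q (q ^ 2)) ∧
    (∀ N : ℕ, Odd N →
      q ^ ((alpha N : ℝ) ^ 2 / 4) * qPochInf (-q ^ (1 + (alpha N : ℝ))) (q ^ 2) *
          qPochInf (-q ^ (1 - (alpha N : ℝ))) (q ^ 2) / qPochInf q (q ^ 2) =
        q ^ ((1 : ℝ) / 4) * qPochInf (-1) (q ^ 2) * qPochInf (-q ^ 2) (q ^ 2) /
          qPochInf q (q ^ 2)) ∧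
    -- the case `L = 2`
    AsympEq (fun N : ℕ => q ^ (5 * (N : ℝ) ^ 2 / 2 + 2 * (N : ℝ)) * Zhat q 2 N)
      (fun N : ℕ =>
        q ^ (((alpha N : ℝ) - 1) ^ 2 / 2) / 4 * qPochInf (-q) q * qPochInf (-1) q *
          (-(qPochInf q q ^ 2 * qPochInf q (q ^ 2) ^ 2 *
                qPochInf (q ^ ((alpha N : ℝ) - 1 / 2)) q *
                qPochInf (q ^ (3 / 2 - (alpha N : ℝ))) q) +
            qPochInf (-q ^ ((alpha N : ℝ) - 1 / 2)) q *
              qPochInf (-q ^ (3 / 2 - (alpha N : ℝ))) q)) := by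
  have hp := qPochInf_self_pos hq0 hq1
  refine ⟨?_, fun N => ?_, fun N hN => ?_, fun N hN => ?_, ?_⟩
  · simp only [Zhat_one_eq hq0]
    refine asympEq_alpha (u := fun a => centeredSum q fun j => q ^ (((j : ℝ) + (a : ℝ) / 2) ^ 2))
      (l := fun a => q ^ ((a : ℝ) ^ 2 / 4) * theta q (q ^ (a : ℝ)) / qPochInf q q)
      (fun a => ?_) fun a => ?_
    · have h := tendsto_centeredSum hq0 hq1 (summable_rpow_shift_sq hq0 hq1 a)
      rwa [tsum_rpow_shift_sq hq0, inv_mul_eq_div] at h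
    · rw [← tsum_rpow_shift_sq hq0]
      exact (div_pos ((summable_rpow_shift_sq hq0 hq1 a).tsum_pos
        (fun j => (Real.rpow_pos_of_pos hq0 _).le) 0 (Real.rpow_pos_of_pos hq0 _)) hp).ne'
  · have h := qPochInf_even_mul_odd q hq0 hq1
    rw [← pow_two] at h
    have hne := h.trans_ne hp.ne'
    have h1 := left_ne_zero_of_mul hne
    have h2 := right_ne_zero_of_mul hne
    rw [theta_rpow_eq hq0 hq1, ← h]
    field_simp
  · rw [alpha_of_even hN]
    simp [pow_two]
  · rw [alpha_of_odd hN]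
    norm_num
  · simp only [Zhat_two_eq hq0 hq1, limit_two_eq hq0 hq1]
    refine asympEq_alpha
      (u := fun a N => centeredSum q (shiftTerm q a) N *
        centeredSum q (fun j => (1 + 2 * ((j : ℝ) + (a : ℝ) / 2)) * shiftTerm q a j) N)
      (l := fun a => (qPochInf q q)⁻¹ * (∑' j, shiftTerm q a j) * ((qPochInf q q)⁻¹ *
        ∑' j : ℤ, (1 + 2 * ((j : ℝ) + (a : ℝ) / 2)) * shiftTerm q a j))
      (fun a => ?_) fun a => ?_
    · exact (tendsto_centeredSum hq0 hq1 (summable_shiftTerm hq0 hq1 a)).mul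
        (tendsto_centeredSum hq0 hq1 (summable_linear_mul_shiftTerm hq0 hq1 a))
    · exact (mul_pos (mul_pos (inv_pos.mpr hp) (tsum_shiftTerm_pos hq0 hq1 a))
        (mul_pos (inv_pos.mpr hp) (tsum_linear_mul_shiftTerm_pos hq0 hq1 a))).ne'
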